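/- Let $\mathcal H$ be a real Hilbert space. Let $f:\mathcal H\to\mathbb R$ be convex, twice continuously differentiable and bounded below, and suppose that $\nabla f$ is Lipschitz continuous on the bounded subsets of $\mathcal H$. Let $\phi:\mathcal H\to\mathbb R_+$ be a damping potential, that is: $\phi$ is nonnegative, convex and continuous; $\phi(0)=0=\min_{\mathcal H}\phi$; and for every $R>0$, $\sup_{\|u\|\le R}\|(\partial\phi)^0(u)\|<+\infty$, where $(\partial\phi)^0(u)$ denotes the element of minimal norm of the convex subdifferential $\partial\phi(u)$. Let $\beta\ge 0$. Consider the differential inclusion $$\text{(ADIGE-VGH)}\qquad \ddot x(t)+\partial\phi\big(\dot x(t)+\beta\nabla f(x(t))\big)+\beta\nabla^2 f(x(t))\dot x(t)+\nabla f(x(t))\ni 0 .$$ A strong global solution of (ADIGE-VGH) is a function $x\in\mathcal C^1([0,+\infty[;\mathcal H)$ such that, for every $T>0$, $\dot x$ is Lipschitz continuous on $(0,T)$ and $\ddot x\in L^\infty(0,T;\mathcal H)$, and such that for almost every $t>0$ the function $\dot x$ is differentiable at $t$ and the inclusion holds at $t$. Then, for any Cauchy data $(x_0,x_1)\in\mathcal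 H\times\mathcal H$, there exists a unique strong global solution $x:[0,+\infty[\to\mathcal H$ of (ADIGE-VGH) satisfying $x(0)=x_0$ and $\dot x(0)=x_1$. -/

import Mathlib

open Set MeasureTheory Topology
open scoped NNReal ENNReal

namespace ADIGE

variable {H : Type*} [NormedAddCommGroup H] [InnerProductSpace ℝ H]

/-- The convex subdifferential `∂φ(u)` of a real-valued function on a real Hilbert space. -/
def subdifferential (φ : H → ℝ) (u : H) : Set H :=
  {p | ∀ w : H, φ u + inner ℝ p (w - u) ≤ φ w}

/-- `p = (∂φ)⁰(u)`: `p` is an element of minimal norm of `∂φ(u)`. -/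
def IsMinimalSection (φ : H → ℝ) (u p : H) : Prop :=
  p ∈ subdifferential φ u ∧ ∀ q ∈ subdifferential φ u, ‖p‖ ≤ ‖q‖

/-- Damping potentials: nonnegative convex continuous functions with `φ 0 = 0 = min φ`, for which
the minimal section of the subdifferential is bounded on bounded sets. -/
structure IsDampingPotential (φ : H → ℝ) : Prop where
  nonneg : ∀ u, 0 ≤ φ u
  convex : ConvexOn ℝ univ φ
  continuous : Continuous φ
  map_zero : φ 0 = 0
  bounded_minimalSection :
    ∀ R : ℝ, 0 < R → ∃ M : ℝ, ∀ u p : H, ‖u‖ ≤ R → IsMinimalSection φ u p → ‖p‖ ≤ M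

/-- The minimal section is well defined: for `φ` convex and continuous, every `∂φ(u)` has exactly
one element of minimal norm. -/
theorem existsUnique_isMinimalSection [CompleteSpace H] {φ : H → ℝ} (hc : ConvexOn ℝ univ φ)
    (hcont : Continuous φ) (u : H) : ∃! p, IsMinimalSection φ u p := by
  have hne : (subdifferential φ u).Nonempty := by
    have ho : IsOpen {z : H × ℝ | φ z.1 < z.2} :=
      isOpen_lt (hcont.comp continuous_fst) continuous_snd
    have hconv : Convex ℝ {z : H × ℝ | φ z.1 < z.2} := by
      have := hc.convex_strict_epigraph
      simpa using this
    obtain ⟨g, hg⟩ := geometric_hahn_banach_open_point hconv ho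
      (x := (u, φ u)) (by simp)
    have hsplit : ∀ (x : H) (r : ℝ), g (x, r) = g (x, 0) + r * g (0, 1) := by
      intro x r
      have : ((x, r) : H × ℝ) = (x, 0) + r • (0, 1) := by simp
      rw [this, map_add, map_smul, smul_eq_mul]
    set c := g (0, 1) with hcdef
    have hcneg : c < 0 := by
      have := hg (u, φ u + 1) (by simp)
      rw [hsplit u (φ u + 1), hsplit u (φ u)] at this
      linarith
    let l : StrongDual ℝ H := g.comp (ContinuousLinearMap.inl ℝ H ℝ)
    have hc0 : c ≠ 0 := hcneg.ne
    have hl : ∀ x, l x = g (x, 0) := fun x => by simp [l]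
    refine ⟨(InnerProductSpace.toDual ℝ H).symm ((-c⁻¹) • l), fun w => ?_⟩
    rw [InnerProductSpace.toDual_symm_apply]
    have hle : l w + φ w * c ≤ l u + φ u * c := by
      refine le_of_forall_pos_lt_add fun ε hε => ?_
      have h1 := hg (w, φ w + ε / (-c)) (by
        have : 0 < ε / (-c) := div_pos hε (by linarith)
        change φ w < φ w + ε / (-c)
        linarith)
      rw [hsplit w _, hsplit u (φ u), ← hl, ← hl, add_mul] at h1
      have h2 : ε / (-c) * c = -ε := by
        rw [div_neg, neg_mul, div_mul_cancel₀ _ hc0]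
      linarith
    have h3 : ((-c⁻¹) • l) (w - u) = (-c⁻¹) * (l w - l u) := by
      rw [smul_apply, map_sub, smul_eq_mul]
    rw [h3]
    have h4 : 0 < -c⁻¹ := by simpa using inv_lt_zero.mpr hcneg
    have h5 : (-c⁻¹) * (l w - l u) ≤ (-c⁻¹) * ((φ u - φ w) * c) :=
      mul_le_mul_of_nonneg_left (by linarith) h4.le
    have h6 : (-c⁻¹) * ((φ u - φ w) * c) = φ w - φ u := by
      have : c⁻¹ * c = 1 := inv_mul_cancel₀ hc0
      linear_combination (φ w - φ u) * this
    linarith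
  have hclosed : IsClosed (subdifferential φ u) := by
    have : subdifferential φ u = ⋂ w : H, {p | φ u + inner ℝ p (w - u) ≤ φ w} := by
      ext p; simp [subdifferential]
    rw [this]
    exact isClosed_iInter fun w => isClosed_le (by fun_prop) continuous_const
  have hcx : Convex ℝ (subdifferential φ u) := by
    intro p hp q hq a b ha hb hab w
    have h1 := mul_le_mul_of_nonneg_left (hp w) ha
    have h2 := mul_le_mul_of_nonneg_left (hq w) hb
    rw [inner_add_left, real_inner_smul_left, real_inner_smul_left]
    have h3 : a = 1 - b := by linarith
    subst h3
    nlinarith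
  obtain ⟨p, hp, hpm⟩ := exists_norm_eq_iInf_of_complete_convex hne hclosed.isComplete hcx (0 : H)
  have hmin := (norm_eq_iInf_iff_real_inner_le_zero hcx hp).1 hpm
  have hle : ∀ q ∈ subdifferential φ u, ‖p‖ ^ 2 ≤ inner ℝ p q := by
    intro q hq
    have := hmin q hq
    rw [zero_sub, inner_neg_left, inner_sub_right, real_inner_self_eq_norm_sq] at this
    linarith
  refine ⟨p, ⟨hp, fun q hq => ?_⟩, fun q hq => ?_⟩
  · have h1 := (hle q hq).trans (real_inner_le_norm p q)
    nlinarith [norm_nonneg p, norm_nonneg q]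
  · have h1 := hle q hq.1
    have h2 := hq.2 p hp
    have h3 : ‖q - p‖ ^ 2 = ‖q‖ ^ 2 - 2 * inner ℝ q p + ‖p‖ ^ 2 := norm_sub_sq_real q p
    rw [real_inner_comm] at h1
    have h4 : ‖q - p‖ ^ 2 ≤ 0 := by nlinarith [norm_nonneg p, norm_nonneg q]
    have h5 : ‖q - p‖ = 0 := by nlinarith [norm_nonneg (q - p)]
    exact sub_eq_zero.1 (norm_eq_zero.1 h5)

/-- Lipschitz continuity on the bounded subsets of the space. -/
def LipschitzOnBounded (F : H → H) : Prop :=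
  ∀ s : Set H, Bornology.IsBounded s → ∃ K : ℝ≥0, LipschitzOnWith K F s

/-- The Hessian `∇²f(x)` as a continuous linear operator. -/
noncomputable def hessian [CompleteSpace H] (f : H → ℝ) (x : H) : H →L[ℝ] H :=
  fderiv ℝ (gradient f) x

/-- The velocity `ẋ` of a trajectory defined on `[0, +∞)` (one-sided derivative at `0`).
Trajectories are represented by functions on `ℝ`; values at negative times play no role. -/
noncomputable def velocity (x : ℝ → H) (t : ℝ) : H :=
  derivWithin x (Ici 0) t

/-- The acceleration `ẍ`; it is only used at times `t > 0`. -/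
noncomputable def acceleration (x : ℝ → H) (t : ℝ) : H :=
  deriv (velocity x) t

/-- Strong global solutions on `[0, +∞)` of
`ẍ + ∂φ(ẋ + β ∇f(x)) + β ∇²f(x) ẋ + ∇f(x) ∋ 0`. -/
structure IsStrongGlobalSolution [CompleteSpace H] (f φ : H → ℝ) (β : ℝ) (x : ℝ → H) :
    Prop where
  contDiffOn : ContDiffOn ℝ 1 x (Ici 0)
  lipschitz_velocity : ∀ T : ℝ, 0 < T → ∃ K : ℝ≥0, LipschitzOnWith K (velocity x) (Ioo 0 T)
  memLp_acceleration : ∀ T : ℝ, 0 < T → MemLp (acceleration x) ∞ (volume.restrict (Ioo 0 T))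
  inclusion : ∀ᵐ t ∂(volume.restrict (Ioi (0 : ℝ))),
    DifferentiableAt ℝ (velocity x) t ∧
    ∃ p ∈ subdifferential φ (velocity x t + β • gradient f (x t)),
      acceleration x t + p + β • hessian f (x t) (velocity x t) + gradient f (x t) = 0

end ADIGE

/-!
The substitution `v = ẋ + β ∇f(x)` turns the inclusion into the first-order system
`ẋ = v - β ∇f(x)`, `v̇ + ∂φ(v) + ∇f(x) ∋ 0`, which no longer involves the Hessian. As `∂φ` is
monotone and `∇f` is Lipschitz on bounded sets, the field `(v - β ∇f(x), -p - ∇f(x))` with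
`p ∈ ∂φ(v)` is one-sided Lipschitz on bounded sets. Uniqueness is then Grönwall's inequality for the
squared distance of two solutions.

For existence, the damping makes the energy `f(x) + ‖v‖² / 2` almost nonincreasing along the Euler
polygons of the discontinuous field given by `p = (∂φ)⁰(v)`, so that on a given time interval they
stay in a fixed bounded set; one-sided Lipschitz continuity makes them a Cauchy sequence. Their
limit is Lipschitz, hence differentiable almost everywhere (its values span a separable subspace),
and its derivative lies in the closed convex hull of the values of the field near the limit point.
Since the graph of `∂φ` is closed with convex fibres, this is the inclusion.
-/

namespace ADIGE

open Filter

section MeanValue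

variable {E : Type*} [NormedAddCommGroup E] [NormedSpace ℝ E]

theorem slope_mem_of_hasDerivWithinAt_mem {z z' : ℝ → E} {r s : ℝ} {C : Set E}
    (hC : Convex ℝ C) (hC' : IsClosed C) (hrs : r < s) (hz : ContinuousOn z (Icc r s))
    (hz' : ∀ t ∈ Ico r s, HasDerivWithinAt z (z' t) (Ici t) t) (hmem : ∀ t ∈ Ico r s, z' t ∈ C) :
    slope z r s ∈ C := by
  by_contra hslope
  obtain ⟨l, c, hlC, hlslope⟩ := geometric_hahn_banach_closed_point hC hC' hslope
  have hle : l (z s) ≤ l (z r) + c * (s - r) :=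
    image_le_of_deriv_right_le_deriv_boundary (f := fun t => l (z t)) (f' := fun t => l (z' t))
      (B := fun t => l (z r) + c * (t - r)) (B' := fun _ => c)
      (l.continuous.comp_continuousOn hz)
      (fun t ht => l.hasFDerivAt.comp_hasDerivWithinAt t (hz' t ht)) (by simp)
      (by fun_prop)
      (fun t _ => by
        simpa using (((hasDerivAt_id t).sub_const r).const_mul c).const_add (l (z r))
          |>.hasDerivWithinAt)
      (fun t ht => (hlC _ (hmem t ht)).le) (right_mem_Icc.2 hrs.le)
  rw [slope_def_module, map_smul, map_sub, smul_eq_mul, inv_mul_eq_div,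
    lt_div_iff₀ (sub_pos.2 hrs)] at hlslope
  linarith

end MeanValue

section Rademacher

section NormedSpace

variable {E : Type*} [NormedAddCommGroup E] [NormedSpace ℝ E] [CompleteSpace E]

theorem integral_deriv_eq_sub_of_lipschitzWith {v : ℝ → E} {K : ℝ≥0} (hv : LipschitzWith K v)
    (hd : ∀ᵐ t, DifferentiableAt ℝ v t) (a b : ℝ) : ∫ t in a..b, deriv v t = v b - v a := by
  have hli : LocallyIntegrable (deriv v) volume :=
    (memLp_top_of_bound (aestronglyMeasurable_deriv v _) K
      (Eventually.of_forall fun _ => norm_deriv_le_of_lipschitz hv)).locallyIntegrable le_top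
  have hint : ∀ c d, IntervalIntegrable (deriv v) volume c d := fun c d =>
    (hli.integrableOn_isCompact isCompact_uIcc).intervalIntegrable
  have hlip : LipschitzWith K fun t => ∫ s in a..t, deriv v s :=
    LipschitzWith.of_dist_le_mul fun s t => by
      rw [dist_eq_norm, intervalIntegral.integral_interval_sub_left (hint _ _) (hint _ _),
        Real.dist_eq]
      exact intervalIntegral.norm_integral_le_of_norm_le_const fun _ _ =>
        norm_deriv_le_of_lipschitz hv
  have hac : AbsolutelyContinuousOnInterval (fun t => v t - ∫ s in a..t, deriv v s) a b :=
    (hv.lipschitzOnWith (s := uIcc a b)).absolutelyContinuousOnInterval.sub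
      (hlip.lipschitzOnWith (s := uIcc a b)).absolutelyContinuousOnInterval
  obtain ⟨C, hC⟩ := hac.const_of_ae_hasDerivAt_zero (by
    filter_upwards [hd, LocallyIntegrable.ae_hasDerivAt_integral hli] with t hvt hIt _
    simpa only [sub_self] using hvt.hasDerivAt.fun_sub (hIt a))
  have hCa := hC a left_mem_uIcc
  rw [intervalIntegral.integral_same, sub_zero] at hCa
  rw [hCa, ← hC b right_mem_uIcc, sub_sub_cancel]

theorem ae_differentiableAt_of_tendsto {v : ℝ → E} {w : ℕ → ℝ → E} {K : ℝ≥0}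
    (hw : ∀ n, LipschitzWith K (w n)) (hwd : ∀ n, ∀ᵐ t, DifferentiableAt ℝ (w n) t)
    (hwv : ∀ t, Tendsto (fun n => w n t) atTop (𝓝 (v t)))
    (hlim : ∀ᵐ t, ∃ l, Tendsto (fun n => deriv (w n) t) atTop (𝓝 l)) :
    ∀ᵐ t, DifferentiableAt ℝ v t := by
  obtain ⟨g, hgm, hg⟩ := exists_stronglyMeasurable_limit_of_tendsto_ae
    (fun n => aestronglyMeasurable_deriv (w n) volume) hlim
  have hgK : ∀ᵐ t, ‖g t‖ ≤ K := by
    filter_upwards [hg] with t ht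
    exact le_of_tendsto' ht.norm fun n => norm_deriv_le_of_lipschitz (hw n)
  have hli : LocallyIntegrable g volume :=
    (memLp_top_of_bound hgm.aestronglyMeasurable K hgK).locallyIntegrable le_top
  have hftc : ∀ t, ∫ s in (0 : ℝ)..t, g s = v t - v 0 := fun t => by
    have hint : Tendsto (fun n => ∫ s in (0 : ℝ)..t, deriv (w n) s) atTop
        (𝓝 (∫ s in (0 : ℝ)..t, g s)) :=
      intervalIntegral.tendsto_integral_filter_of_dominated_convergence (fun _ => (K : ℝ))
        (Eventually.of_forall fun _ => aestronglyMeasurable_deriv _ _)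
        (Eventually.of_forall fun n => Eventually.of_forall fun _ _ =>
          norm_deriv_le_of_lipschitz (hw n)) intervalIntegrable_const
        (hg.mono fun _ hs _ => hs)
    simp only [fun n => integral_deriv_eq_sub_of_lipschitzWith (hw n) (hwd n) 0 t] at hint
    exact tendsto_nhds_unique hint ((hwv t).sub (hwv 0))
  have hv : v = fun t => (∫ s in (0 : ℝ)..t, g s) + v 0 :=
    funext fun t => by rw [hftc, sub_add_cancel]
  filter_upwards [LocallyIntegrable.ae_hasDerivAt_integral hli] with t ht
  rw [hv]
  exact ((ht 0).add_const _).differentiableAt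

end NormedSpace

variable {H : Type*} [NormedAddCommGroup H] [InnerProductSpace ℝ H]

theorem cauchySeq_of_starProjection_eq (U : ℕ → Submodule ℝ H)
    [∀ n, (U n).HasOrthogonalProjection] {g : ℕ → H} {K : ℝ}
    (hg : ∀ n m, n ≤ m → (U n).starProjection (g m) = g n) (hK : ∀ n, ‖g n‖ ≤ K) :
    CauchySeq g := by
  have pythagoras : ∀ n m, n ≤ m → ‖g m - g n‖ ^ 2 = ‖g m‖ ^ 2 - ‖g n‖ ^ 2 := fun n m h => by
    have := (U n).norm_sq_eq_add_norm_sq_starProjection (g m)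
    rw [Submodule.starProjection_orthogonal_val, hg n m h] at this
    linarith
  have hmono : Monotone fun n => ‖g n‖ ^ 2 := fun n m h => by
    simpa only [sub_nonneg] using (sq_nonneg _).trans_eq (pythagoras n m h)
  have hbdd : BddAbove (range fun n => ‖g n‖ ^ 2) :=
    ⟨K ^ 2, forall_mem_range.2 fun n => pow_le_pow_left₀ (norm_nonneg _) (hK n) 2⟩
  have hcauchy := (tendsto_atTop_ciSup hmono hbdd).cauchySeq
  rw [Metric.cauchySeq_iff'] at hcauchy ⊢
  intro ε hε
  obtain ⟨N, hN⟩ := hcauchy (ε ^ 2) (by positivity)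
  refine ⟨N, fun n hn => ?_⟩
  have hlt := lt_of_abs_lt (hN n hn)
  rw [← pythagoras N n hn] at hlt
  rw [dist_eq_norm]
  exact lt_of_pow_lt_pow_left₀ 2 hε.le hlt

theorem ae_differentiableAt_starProjection (U : Submodule ℝ H) [FiniteDimensional ℝ U]
    {v : ℝ → H} {K : ℝ≥0} (hv : LipschitzWith K v) :
    ∀ᵐ t, DifferentiableAt ℝ (fun s => U.starProjection (v s)) t := by
  filter_upwards [(U.lipschitzWith_orthogonalProjectionOnto.comp hv).ae_differentiableAt_real]
    with t ht
  exact U.subtypeL.differentiableAt.comp t ht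

theorem exists_monotone_tendsto_starProjection [CompleteSpace H] {X : Type*} [TopologicalSpace X]
    [TopologicalSpace.SeparableSpace X] [Nonempty X] {v : X → H} (hv : Continuous v) :
    ∃ (U : ℕ → Submodule ℝ H) (_ : ∀ n, FiniteDimensional ℝ (U n)), Monotone U ∧
      ∀ x, Tendsto (fun n => (U n).starProjection (v x)) atTop (𝓝 (v x)) := by
  let U : ℕ → Submodule ℝ H := fun n =>
    Submodule.span ℝ ((fun i => v (TopologicalSpace.denseSeq X i)) '' Iio n)
  have hfin : ∀ n, FiniteDimensional ℝ (U n) := fun n =>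
    FiniteDimensional.span_of_finite ℝ ((finite_Iio n).image _)
  have hmono : Monotone U := fun n m h => Submodule.span_mono (image_mono (Iio_subset_Iio h))
  refine ⟨U, hfin, hmono, fun x => ?_⟩
  have hmem : v x ∈ (⨆ n, U n).topologicalClosure := by
    have hx : v x ∈ closure (v '' range (TopologicalSpace.denseSeq X)) :=
      image_closure_subset_closure_image hv ⟨x, TopologicalSpace.denseRange_denseSeq X x, rfl⟩
    refine closure_mono ?_ hx
    rintro _ ⟨_, ⟨i, rfl⟩, rfl⟩
    exact Submodule.mem_iSup_of_mem (i + 1) (Submodule.subset_span ⟨i, Nat.lt_succ_self i, rfl⟩)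
  have hlim := Submodule.starProjection_tendsto_closure_iSup U hmono (v x)
  rwa [Submodule.starProjection_eq_self_iff.2 hmem] at hlim

variable [CompleteSpace H]

theorem ae_differentiableAt_of_lipschitzWith {v : ℝ → H} {K : ℝ≥0} (hv : LipschitzWith K v) :
    ∀ᵐ t, DifferentiableAt ℝ v t := by
  obtain ⟨U, _, hmono, hlim⟩ := exists_monotone_tendsto_starProjection hv.continuous
  have hlip : ∀ n, LipschitzWith K fun t => (U n).starProjection (v t) := fun n => by
    simpa only [one_mul] using! (U n).lipschitzWith_starProjection.comp hv
  have hdiff := fun n => ae_differentiableAt_starProjection (U n) hv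
  refine ae_differentiableAt_of_tendsto hlip hdiff hlim ?_
  filter_upwards [ae_all_iff.2 hdiff] with t ht
  refine cauchySeq_tendsto_of_complete (cauchySeq_of_starProjection_eq U (fun n m hnm => ?_)
    fun n => norm_deriv_le_of_lipschitz (hlip n))
  have hcomp : (fun s => (U n).starProjection (v s)) =
      fun s => (U n).starProjection ((U m).starProjection (v s)) := funext fun s =>
    (DFunLike.congr_fun (Submodule.starProjection_comp_starProjection_of_le (hmono hnm)) (v s)).symm
  rw [hcomp]
  exact ((U n).starProjection.hasFDerivAt.comp_hasDerivAt t (ht m).hasDerivAt).deriv.symm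

theorem ae_differentiableAt_of_lipschitzOnWith_Icc {v : ℝ → H} {K : ℝ≥0} {a b : ℝ}
    (hv : LipschitzOnWith K v (Icc a b)) : ∀ᵐ t, t ∈ Ioo a b → DifferentiableAt ℝ v t := by
  rcases le_or_gt b a with hab | hab
  · simp [Ioo_eq_empty_of_le hab]
  have hlip : LipschitzWith K fun t => v (projIcc a b hab.le t) := by
    simpa only [mul_one] using! hv.to_restrict.comp (LipschitzWith.projIcc hab.le)
  filter_upwards [ae_differentiableAt_of_lipschitzWith hlip] with t ht htab
  refine ht.congr_of_eventuallyEq ?_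
  filter_upwards [Ioo_mem_nhds htab.1 htab.2] with s hs
  rw [projIcc_of_mem hab.le (Ioo_subset_Icc_self hs)]

theorem ae_differentiableAt_of_forall_lipschitzOnWith_Icc {v : ℝ → H}
    (hv : ∀ T > 0, ∃ K : ℝ≥0, LipschitzOnWith K v (Icc 0 T)) :
    ∀ᵐ t, 0 < t → DifferentiableAt ℝ v t := by
  have hdiff : ∀ n : ℕ, ∀ᵐ t, t ∈ Ioo (0 : ℝ) (n + 1) → DifferentiableAt ℝ v t := fun n =>
    have ⟨_, hK⟩ := hv (n + 1) n.cast_add_one_pos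
    ae_differentiableAt_of_lipschitzOnWith_Icc hK
  filter_upwards [ae_all_iff.2 hdiff] with t ht ht₀
  exact ht ⌊t⌋₊ ⟨ht₀, Nat.lt_floor_add_one t⟩

end Rademacher

section ApproxSolution

variable {E : Type*} [NormedAddCommGroup E]

section NormedSpace

variable [NormedSpace ℝ E]

/-- `z` is an `ε`-approximate solution of `ż = F(z)` on `[0, T]`: at every time its right derivative
is a value of `F` at a point of `B` within distance `ε` of `z`. -/
structure IsApproxSolution (F : E → E) (B : Set E) (ε T : ℝ) (z : ℝ → E) : Prop where
  continuousOn : ContinuousOn z (Icc 0 T)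
  hasDerivWithinAt : ∀ t ∈ Ico 0 T, ∃ a ∈ B, ‖z t - a‖ ≤ ε ∧ HasDerivWithinAt z (F a) (Ici t) t

/-- `z` is a Krasovskii solution of `ż = F(z)` on `[0, +∞)`, for a possibly discontinuous field `F`.
The usual requirement that `ż(t)` belong almost everywhere to the closed convex hull of `F(U)`, for
every neighbourhood `U` of `z(t)`, is replaced by a condition on difference quotients, equivalent to
it in Hilbert spaces, which makes sense at every time. -/
structure IsKrasovskiiSolution (F : E → E) (z : ℝ → E) : Prop where
  lipschitz : ∀ T > 0, ∃ K : ℝ≥0, LipschitzOnWith K z (Icc 0 T)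
  slope_mem : ∀ t ≥ 0, ∀ U ∈ 𝓝 (z t),
    ∀ᶠ s in 𝓝[Ici 0 \ {t}] t, slope z t s ∈ closedConvexHull ℝ (F '' U)

variable {F : E → E} {B : Set E} {M : ℝ≥0} {ε T : ℝ} {z : ℝ → E}

namespace IsApproxSolution

theorem lipschitzOnWith (hz : IsApproxSolution F B ε T z) (hF : ∀ a ∈ B, ‖F a‖ ≤ M) :
    LipschitzOnWith M z (Icc 0 T) := by
  choose! a ha _ hderiv using hz.hasDerivWithinAt
  have hle : ∀ s ∈ Icc 0 T, ∀ t ∈ Icc 0 T, s ≤ t → dist (z t) (z s) ≤ M * dist t s := by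
    intro s hs t ht hst
    rw [dist_eq_norm, Real.dist_eq, abs_of_nonneg (sub_nonneg.2 hst)]
    have hsub : Ico s t ⊆ Ico 0 T := Ico_subset_Ico hs.1 ht.2
    exact norm_image_sub_le_of_norm_deriv_right_le_segment (f' := F ∘ a)
      (hz.continuousOn.mono (Icc_subset_Icc hs.1 ht.2)) (fun r hr => hderiv r (hsub hr))
      (fun r hr => hF _ (ha r (hsub hr))) t (right_mem_Icc.2 hst)
  refine LipschitzOnWith.of_dist_le_mul fun t ht s hs => ?_
  rcases le_total s t with hst | hst
  · exact hle s hs t ht hst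
  · rw [dist_comm, dist_comm t]
    exact hle t ht s hs hst

theorem slope_mem (hz : IsApproxSolution F B ε T z) {U : Set E} {r s : ℝ} (hr : r ∈ Icc 0 T)
    (hs : s ∈ Icc 0 T) (hrs : r ≠ s) (hU : ∀ t ∈ uIcc r s, Metric.closedBall (z t) ε ⊆ U) :
    slope z r s ∈ closedConvexHull ℝ (F '' U) := by
  wlog hlt : r < s generalizing r s
  · rw [slope_comm]
    exact this hs hr hrs.symm (uIcc_comm r s ▸ hU) (hrs.lt_or_gt.resolve_left hlt)
  rw [uIcc_of_le hlt.le] at hU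
  choose! a _ hdist hderiv using hz.hasDerivWithinAt
  have hsub : Ico r s ⊆ Ico 0 T := Ico_subset_Ico hr.1 hs.2
  refine slope_mem_of_hasDerivWithinAt_mem convex_closedConvexHull isClosed_closedConvexHull hlt
    (hz.continuousOn.mono (Icc_subset_Icc hr.1 hs.2)) (fun t ht => hderiv t (hsub ht)) fun t ht =>
    subset_closedConvexHull (mem_image_of_mem F (hU t (Ico_subset_Icc_self ht) ?_))
  rw [mem_closedBall_iff_norm, norm_sub_rev]
  exact hdist t (hsub ht)

end IsApproxSolution

theorem eventually_slope_mem_of_tendsto {u : ℕ → ℝ → E} (hF : ∀ a ∈ B, ‖F a‖ ≤ M)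
    (hu : ∀ ε > 0, ∀ᶠ n in atTop, IsApproxSolution F B ε T (u n))
    (hz : ∀ t ≥ 0, Tendsto (fun n => u n t) atTop (𝓝 (z t))) {t : ℝ} (ht : t ∈ Ico 0 T)
    {U : Set E} (hU : U ∈ 𝓝 (z t)) :
    ∀ᶠ s in 𝓝[Ici 0 \ {t}] t, slope z t s ∈ closedConvexHull ℝ (F '' U) := by
  obtain ⟨ρ, hρ, hρU⟩ := Metric.mem_nhds_iff.1 hU
  have hnear : ∀ᶠ s in 𝓝 t, M * |s - t| < ρ / 3 :=
    (Continuous.tendsto' (by fun_prop) t 0 (by simp)).eventually_lt_const (by positivity)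
  filter_upwards [nhdsWithin_le_nhds hnear, nhdsWithin_le_nhds (Iio_mem_nhds ht.2),
    self_mem_nhdsWithin] with s hs hsT ⟨hs₀, hst⟩
  refine isClosed_closedConvexHull.mem_of_tendsto
    (b := atTop) (f := fun n => slope (u n) t s) ?_ ?_
  · simp only [slope_def_module]
    exact ((hz s hs₀).sub (hz t ht.1)).const_smul _
  filter_upwards [hu (ρ / 4) (by positivity),
    (hz t ht.1).eventually (Metric.ball_mem_nhds _ (by positivity : 0 < ρ / 3))] with n hn hnt
  have hs' : s ∈ Icc 0 T := ⟨hs₀, le_of_lt hsT⟩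
  have ht' : t ∈ Icc 0 T := Ico_subset_Icc_self ht
  refine hn.slope_mem ht' hs' (Ne.symm hst) fun r hr => ?_
  refine (Metric.closedBall_subset_ball' ?_).trans hρU
  have hlip := (hn.lipschitzOnWith hF).dist_le_mul r (uIcc_subset_Icc ht' hs' hr) t ht'
  rw [Real.dist_eq] at hlip
  linarith [mul_le_mul_of_nonneg_left (abs_sub_left_of_mem_uIcc hr) M.coe_nonneg,
    dist_triangle (u n r) (u n t) (z t), Metric.mem_ball.1 hnt]

theorem isKrasovskiiSolution_of_tendsto {u : ℕ → ℝ → E}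
    (hu : ∀ T > 0, ∃ (B : Set E) (M : ℝ≥0), (∀ a ∈ B, ‖F a‖ ≤ M) ∧
      ∀ ε > 0, ∀ᶠ n in atTop, IsApproxSolution F B ε T (u n))
    (hz : ∀ t ≥ 0, Tendsto (fun n => u n t) atTop (𝓝 (z t))) : IsKrasovskiiSolution F z where
  lipschitz T hT := by
    obtain ⟨B, M, hF, happrox⟩ := hu T hT
    refine ⟨M, LipschitzOnWith.of_dist_le_mul fun s hs t ht => ?_⟩
    refine le_of_tendsto ((hz s hs.1).dist (hz t ht.1)) ?_
    filter_upwards [happrox 1 one_pos] with n hn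
    exact (hn.lipschitzOnWith hF).dist_le_mul s hs t ht
  slope_mem t ht U hU := by
    obtain ⟨B, M, hF, happrox⟩ := hu (t + 1) (by positivity)
    exact eventually_slope_mem_of_tendsto hF happrox hz ⟨ht, lt_add_one t⟩ hU

namespace IsKrasovskiiSolution

theorem hasDerivWithinAt_comp (hz : IsKrasovskiiSolution F z) {G : Type*} [NormedAddCommGroup G]
    [NormedSpace ℝ G] (P : E →L[ℝ] G) {t : ℝ} (ht : 0 ≤ t)
    (hPF : ContinuousAt (fun a => P (F a)) (z t)) :
    HasDerivWithinAt (fun s => P (z s)) (P (F (z t))) (Ici 0) t := by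
  rw [hasDerivWithinAt_iff_tendsto_slope, Metric.nhds_basis_closedBall.tendsto_right_iff]
  intro ε hε
  filter_upwards [hz.slope_mem t ht _ (hPF (Metric.closedBall_mem_nhds _ hε))] with s hs
  have hsub := closedConvexHull_min (image_subset_iff.2 Subset.rfl : F '' _ ⊆ _)
    ((convex_closedBall (P (F (z t))) ε).linear_preimage P.toLinearMap)
    (Metric.isClosed_closedBall.preimage P.continuous) hs
  rwa [mem_preimage, ContinuousLinearMap.coe_coe, slope_def_module, map_smul, map_sub] at hsub

theorem mem_closedConvexHull_of_hasDerivWithinAt (hz : IsKrasovskiiSolution F z) {t : ℝ}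
    (ht : 0 ≤ t) {z' : E} (hz' : HasDerivWithinAt z z' (Ici 0) t) {U : Set E} (hU : U ∈ 𝓝 (z t)) :
    z' ∈ closedConvexHull ℝ (F '' U) := by
  have hle : 𝓝[>] t ≤ 𝓝[Ici 0 \ {t}] t :=
    nhdsWithin_mono t fun s hs => ⟨ht.trans (le_of_lt hs), ne_of_gt hs⟩
  exact isClosed_closedConvexHull.mem_of_tendsto
    ((hasDerivWithinAt_iff_tendsto_slope.1 hz').mono_left hle)
    ((hz.slope_mem t ht U hU).filter_mono hle)

theorem apply_le_of_hasDerivWithinAt (hz : IsKrasovskiiSolution F z) (l : StrongDual ℝ E)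
    {Θ : E → ℝ} {t : ℝ} (ht : 0 ≤ t) {z' : E} (hz' : HasDerivWithinAt z z' (Ici 0) t)
    (hΘ : ContinuousAt Θ (z t)) (hl : ∀ᶠ a in 𝓝 (z t), l (F a) ≤ Θ a) : l z' ≤ Θ (z t) := by
  refine le_of_forall_pos_le_add fun ε hε => ?_
  have hU := hl.and (hΘ.eventually_lt_const (lt_add_of_pos_right (Θ (z t)) hε))
  exact closedConvexHull_min (t := {b | l b ≤ Θ (z t) + ε})
    (image_subset_iff.2 fun a ha => ha.1.trans ha.2.le)
    (convex_halfSpace_le l.toLinearMap.isLinear _) (isClosed_le l.continuous continuous_const)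
    (hz.mem_closedConvexHull_of_hasDerivWithinAt ht hz' hU)

end IsKrasovskiiSolution

end NormedSpace

variable [InnerProductSpace ℝ E]

/-- The one-sided Lipschitz condition, under which solutions of `ż = F(z)` separate at most
exponentially. -/
def OneSidedLipschitzOn (L : ℝ≥0) (F : E → E) (B : Set E) : Prop :=
  ∀ a ∈ B, ∀ b ∈ B, inner ℝ (F a - F b) (a - b) ≤ L * ‖a - b‖ ^ 2

variable {F : E → E} {B : Set E} {M L : ℝ≥0} {ε δ T : ℝ} {z w : ℝ → E}

theorem OneSidedLipschitzOn.inner_sub_le (hF : OneSidedLipschitzOn L F B)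
    (hM : ∀ a ∈ B, ‖F a‖ ≤ M) {a b x y : E} (ha : a ∈ B) (hb : b ∈ B) (hxa : ‖x - a‖ ≤ ε)
    (hyb : ‖y - b‖ ≤ δ) :
    2 * inner ℝ (x - y) (F a - F b) ≤
      4 * L * ‖x - y‖ ^ 2 + (4 * L * (ε + δ) ^ 2 + 4 * M * (ε + δ)) := by
  have herr : ‖(x - y) - (a - b)‖ ≤ ε + δ := by
    rw [sub_sub_sub_comm]
    exact (norm_sub_le _ _).trans (add_le_add hxa hyb)
  have hfield : ‖F a - F b‖ ≤ 2 * M := by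
    linarith [norm_sub_le (F a) (F b), hM a ha, hM b hb]
  have hcross : inner ℝ (F a - F b) ((x - y) - (a - b)) ≤ 2 * M * (ε + δ) :=
    (real_inner_le_norm _ _).trans (mul_le_mul hfield herr (norm_nonneg _) (by positivity))
  have hnodes : ‖a - b‖ ^ 2 ≤ 2 * ‖x - y‖ ^ 2 + 2 * (ε + δ) ^ 2 := by
    have htri : ‖a - b‖ ≤ ‖x - y‖ + (ε + δ) := by
      linarith [norm_sub_norm_le (a - b) (x - y), norm_sub_rev (a - b) (x - y)]
    nlinarith [pow_le_pow_left₀ (norm_nonneg _) htri 2, sq_nonneg (‖x - y‖ - (ε + δ))]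
  have hsplit : inner ℝ (x - y) (F a - F b) =
      inner ℝ (F a - F b) (a - b) + inner ℝ (F a - F b) ((x - y) - (a - b)) := by
    rw [← inner_add_right, add_sub_cancel, real_inner_comm]
  nlinarith [hF a ha b hb, mul_le_mul_of_nonneg_left hnodes L.coe_nonneg]

theorem IsApproxSolution.norm_sub_sq_le (hz : IsApproxSolution F B ε T z)
    (hw : IsApproxSolution F B δ T w) (hzw : z 0 = w 0) (hM : ∀ a ∈ B, ‖F a‖ ≤ M)
    (hF : OneSidedLipschitzOn L F B) {t : ℝ} (ht : t ∈ Icc 0 T) :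
    ‖z t - w t‖ ^ 2 ≤ gronwallBound 0 (4 * L) (4 * L * (ε + δ) ^ 2 + 4 * M * (ε + δ)) t := by
  choose! a ha haz hderivz using hz.hasDerivWithinAt
  choose! b hb hbw hderivw using hw.hasDerivWithinAt
  simpa only [sub_zero] using le_gronwallBound_of_liminf_deriv_right_le
    (f := fun s => ‖z s - w s‖ ^ 2)
    (f' := fun s => 2 * inner ℝ (z s - w s) (F (a s) - F (b s)))
    ((hz.continuousOn.sub hw.continuousOn).norm.pow 2)
    (fun s hs _ hr => ((hderivz s hs).sub (hderivw s hs)).norm_sq.liminf_right_slope_le hr)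
    (by simp [hzw])
    (fun s hs => hF.inner_sub_le hM (ha s hs) (hb s hs) (haz s hs) (hbw s hs)) t ht

theorem cauchySeq_of_isApproxSolution {u : ℕ → ℝ → E} (hM : ∀ a ∈ B, ‖F a‖ ≤ M)
    (hF : OneSidedLipschitzOn L F B)
    (hu : ∀ ε > 0, ∀ᶠ n in atTop, IsApproxSolution F B ε T (u n))
    (hu₀ : ∀ m n, u m 0 = u n 0) {t : ℝ} (ht : t ∈ Icc 0 T) : CauchySeq fun n => u n t := by
  rw [Metric.cauchySeq_iff']
  intro r hr
  have hlim : Tendsto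
      (fun ε => gronwallBound 0 (4 * L) (4 * L * (ε + ε) ^ 2 + 4 * M * (ε + ε)) t)
      (𝓝[>] 0) (𝓝 0) := by
    refine tendsto_nhdsWithin_of_tendsto_nhds (Continuous.tendsto' ?_ _ _ ?_)
    · exact (gronwallBound_continuous_ε 0 (4 * L) t).comp (by fun_prop)
    · simp [gronwallBound_ε0_δ0]
  obtain ⟨ε, hsmall, hε⟩ :=
    ((hlim.eventually_lt_const (pow_pos hr 2)).and self_mem_nhdsWithin).exists
  obtain ⟨N, hN⟩ := eventually_atTop.1 (hu ε hε)
  refine ⟨N, fun n hn => ?_⟩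
  rw [dist_eq_norm]
  exact lt_of_pow_lt_pow_left₀ 2 hr.le
    (((hN n hn).norm_sub_sq_le (hN N le_rfl) (hu₀ n N) hM hF ht).trans_lt hsmall)

theorem exists_isKrasovskiiSolution [CompleteSpace E] {u : ℕ → ℝ → E} {z₀ : E}
    (hu : ∀ T > 0, ∃ (B : Set E) (M L : ℝ≥0), (∀ a ∈ B, ‖F a‖ ≤ M) ∧ OneSidedLipschitzOn L F B ∧
      ∀ ε > 0, ∀ᶠ n in atTop, IsApproxSolution F B ε T (u n))
    (hu₀ : ∀ n, u n 0 = z₀) : ∃ z, IsKrasovskiiSolution F z ∧ z 0 = z₀ := by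
  have hlim : ∀ t ≥ 0, ∃ l, Tendsto (fun n => u n t) atTop (𝓝 l) := fun t ht => by
    obtain ⟨B, M, L, hM, hF, happrox⟩ := hu (t + 1) (by positivity)
    exact cauchySeq_tendsto_of_complete (cauchySeq_of_isApproxSolution hM hF happrox
      (fun m n => (hu₀ m).trans (hu₀ n).symm) ⟨ht, (lt_add_one t).le⟩)
  choose! z hz using hlim
  refine ⟨z, isKrasovskiiSolution_of_tendsto (fun T hT => ?_) hz, ?_⟩
  · obtain ⟨B, M, _, hM, _, happrox⟩ := hu T hT
    exact ⟨B, M, hM, happrox⟩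
  · exact tendsto_nhds_unique (hz 0 le_rfl) (by simp only [hu₀, tendsto_const_nhds])

end ApproxSolution

section Euler

variable {E : Type*} [NormedAddCommGroup E]

section NormedSpace

variable [NormedSpace ℝ E]

/-- One step of size `h` of the explicit Euler scheme for `ż = F(z)`. -/
def eulerStep (F : E → E) (h : ℝ) (a : E) : E :=
  a + h • F a

/-- The polygonal interpolation of the explicit Euler scheme of step `h` started at `z₀`: the node
reached at time `⌊t / h⌋ h` is followed by an incomplete step. -/
noncomputable def eulerPath (F : E → E) (h : ℝ) (z₀ : E) (t : ℝ) : E :=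
  eulerStep F (t - ⌊t / h⌋₊ * h) ((eulerStep F h)^[⌊t / h⌋₊] z₀)

theorem floor_div_mul_le {h t : ℝ} (hh : 0 < h) (ht : 0 ≤ t) : ⌊t / h⌋₊ * h ≤ t := by
  rw [← le_div_iff₀ hh]
  exact Nat.floor_le (by positivity)

theorem lt_floor_div_add_one_mul {h : ℝ} (hh : 0 < h) (t : ℝ) : t < (⌊t / h⌋₊ + 1) * h := by
  rw [← div_lt_iff₀ hh]
  exact Nat.lt_floor_add_one _

theorem iterate_eulerStep_mem {F : E → E} {h T : ℝ} {z₀ : E} {S : ℝ → Set E} (hh : 0 ≤ h)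
    (h₀ : z₀ ∈ S 0) (hS : ∀ t ∈ Icc 0 T, ∀ a ∈ S t, eulerStep F h a ∈ S (t + h)) {n : ℕ}
    (hn : n * h ≤ T) : (eulerStep F h)^[n] z₀ ∈ S (n * h) := by
  induction n with
  | zero => simpa using h₀
  | succ n ih =>
    have hn' : n * h ≤ T := by
      push_cast at hn
      linarith
    rw [Function.iterate_succ_apply', Nat.cast_succ, add_one_mul]
    exact hS _ ⟨by positivity, hn'⟩ _ (ih hn')

variable (F : E → E) {h : ℝ} (z₀ : E)

theorem hasDerivAt_eulerStep (a : E) (c t : ℝ) :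
    HasDerivAt (fun s => eulerStep F (s - c) a) (F a) t := by
  simpa only [one_smul] using! (((hasDerivAt_id t).sub_const c).smul_const (F a)).const_add a

theorem eulerPath_zero : eulerPath F h z₀ 0 = z₀ := by
  simp [eulerPath, eulerStep]

theorem eulerPath_eq_of_mem_Icc (hh : 0 < h) {n : ℕ} {t : ℝ} (ht : t ∈ Icc (n * h) ((n + 1) * h)) :
    eulerPath F h z₀ t = eulerStep F (t - n * h) ((eulerStep F h)^[n] z₀) := by
  rcases ht.2.lt_or_eq with hlt | rfl
  · have hfloor : ⌊t / h⌋₊ = n := by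
      rw [Nat.floor_eq_iff (div_nonneg (le_trans (by positivity) ht.1) hh.le), le_div_iff₀ hh,
        div_lt_iff₀ hh]
      exact ⟨ht.1, hlt⟩
    rw [eulerPath, hfloor]
  · have hfloor : ⌊(n + 1) * h / h⌋₊ = n + 1 := by
      rw [mul_div_cancel_right₀ _ hh.ne']
      exact_mod_cast Nat.floor_natCast (R := ℝ) (n + 1)
    rw [eulerPath, hfloor, Function.iterate_succ_apply', Nat.cast_succ, sub_self, ← sub_mul,
      add_sub_cancel_left, one_mul]
    simp only [eulerStep, zero_smul, add_zero]

theorem hasDerivWithinAt_eulerPath (hh : 0 < h) {t : ℝ} (ht : 0 ≤ t) :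
    HasDerivWithinAt (eulerPath F h z₀) (F ((eulerStep F h)^[⌊t / h⌋₊] z₀)) (Ici t) t := by
  refine (hasDerivAt_eulerStep F _ (⌊t / h⌋₊ * h) t).hasDerivWithinAt.congr_of_eventuallyEq ?_ rfl
  filter_upwards [Ico_mem_nhdsGE (lt_floor_div_add_one_mul hh t)] with s hs
  exact eulerPath_eq_of_mem_Icc F z₀ hh ⟨(floor_div_mul_le hh ht).trans hs.1, hs.2.le⟩

theorem continuousOn_eulerPath (hh : 0 < h) : ContinuousOn (eulerPath F h z₀) (Ici 0) := by
  intro t ht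
  have hright := (hasDerivWithinAt_eulerPath F z₀ hh ht).continuousWithinAt
  rcases (mem_Ici.1 ht).eq_or_lt with rfl | hpos
  · exact hright
  refine (continuousAt_iff_continuous_left_right.2 ⟨?_, hright⟩).continuousWithinAt
  obtain ⟨n, hn⟩ := Nat.exists_eq_succ_of_ne_zero (Nat.ceil_pos.2 (div_pos hpos hh)).ne'
  have hlt : n * h < t := by
    rw [← lt_div_iff₀ hh, ← Nat.lt_ceil, hn]
    exact n.lt_succ_self
  have hle : t ≤ (n + 1) * h := by
    rw [← div_le_iff₀ hh]
    exact_mod_cast Nat.ceil_le.1 hn.le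
  refine (hasDerivAt_eulerStep F _ (n * h) t).continuousAt.continuousWithinAt
    |>.congr_of_eventuallyEq ?_ (eulerPath_eq_of_mem_Icc F z₀ hh ⟨hlt.le, hle⟩)
  filter_upwards [Ioc_mem_nhdsLE hlt] with s hs
  exact eulerPath_eq_of_mem_Icc F z₀ hh ⟨hs.1.le, hs.2.trans hle⟩

variable {F z₀}

theorem isApproxSolution_eulerPath {B : Set E} {M : ℝ≥0} {ε T : ℝ} (hM : ∀ a ∈ B, ‖F a‖ ≤ M)
    (hh : 0 < h) (hε : h * M ≤ ε) (hB : ∀ n : ℕ, n * h ≤ T → (eulerStep F h)^[n] z₀ ∈ B) :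
    IsApproxSolution F B ε T (eulerPath F h z₀) where
  continuousOn := (continuousOn_eulerPath F z₀ hh).mono Icc_subset_Ici_self
  hasDerivWithinAt t ht := by
    have hfloor := floor_div_mul_le hh ht.1
    have hmem := hB ⌊t / h⌋₊ (hfloor.trans ht.2.le)
    refine ⟨_, hmem, ?_, hasDerivWithinAt_eulerPath F z₀ hh ht.1⟩
    rw [eulerPath, eulerStep, add_sub_cancel_left, norm_smul, Real.norm_of_nonneg (by linarith)]
    have hrem : t - ⌊t / h⌋₊ * h ≤ h := by linarith [lt_floor_div_add_one_mul hh t]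
    exact (mul_le_mul hrem (hM _ hmem) (norm_nonneg _) hh.le).trans hε

end NormedSpace

theorem exists_isKrasovskiiSolution_of_iterate_eulerStep_mem [InnerProductSpace ℝ E]
    [CompleteSpace E] {F : E → E} {z₀ : E}
    (hF : ∀ T > (0 : ℝ), ∃ (B : Set E) (M L : ℝ≥0), (∀ a ∈ B, ‖F a‖ ≤ M) ∧
      OneSidedLipschitzOn L F B ∧
      ∀ᶠ h in 𝓝[>] (0 : ℝ), ∀ n : ℕ, n * h ≤ T → (eulerStep F h)^[n] z₀ ∈ B) :
    ∃ z, IsKrasovskiiSolution F z ∧ z 0 = z₀ := by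
  have hstep : Tendsto (fun n : ℕ => 1 / ((n : ℝ) + 1)) atTop (𝓝[>] 0) :=
    tendsto_nhdsWithin_iff.2 ⟨tendsto_one_div_add_atTop_nhds_zero_nat,
      Eventually.of_forall fun _ => mem_Ioi.2 Nat.one_div_pos_of_nat⟩
  refine exists_isKrasovskiiSolution (u := fun n => eulerPath F (1 / ((n : ℝ) + 1)) z₀)
    (fun T hT => ?_) fun n => eulerPath_zero F z₀
  obtain ⟨B, M, L, hM, hL, hB⟩ := hF T hT
  refine ⟨B, M, L, hM, hL, fun ε hε => hstep.eventually (p := fun h =>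
    IsApproxSolution F B ε T (eulerPath F h z₀)) ?_⟩
  have hcont : Continuous fun h : ℝ => h * M := by fun_prop
  have hsmall : ∀ᶠ h in 𝓝[>] (0 : ℝ), h * M < ε :=
    nhdsWithin_le_nhds ((hcont.tendsto' 0 0 (zero_mul _)).eventually_lt_const hε)
  filter_upwards [hB, hsmall, self_mem_nhdsWithin] with h hmem hhM hh
  exact isApproxSolution_eulerPath hM hh hhM.le hmem

end Euler

section LipschitzOnBounded

variable {H : Type*} [NormedAddCommGroup H] {g : H → H}

namespace LipschitzOnBounded

theorem exists_lipschitzOnWith_closedBall (hg : LipschitzOnBounded g) (R : ℝ) :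
    ∃ K : ℝ≥0, LipschitzOnWith K g (Metric.closedBall 0 R) :=
  hg _ Metric.isBounded_closedBall

theorem exists_norm_le (hg : LipschitzOnBounded g) (R : ℝ) : ∃ G, ∀ x, ‖x‖ ≤ R → ‖g x‖ ≤ G := by
  obtain ⟨K, hK⟩ := hg.exists_lipschitzOnWith_closedBall R
  refine ⟨‖g 0‖ + K * R, fun x hx => ?_⟩
  have hlip := hK.norm_sub_le (mem_closedBall_zero_iff.2 hx)
    (Metric.mem_closedBall_self ((norm_nonneg x).trans hx))
  rw [sub_zero] at hlip
  linarith [norm_le_insert' (g x) (g 0), mul_le_mul_of_nonneg_left hx K.coe_nonneg]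

theorem continuous (hg : LipschitzOnBounded g) : Continuous g := by
  refine continuous_iff_continuousAt.2 fun x => ?_
  obtain ⟨K, hK⟩ := hg _ (Metric.isBounded_ball (x := x) (r := 1))
  exact hK.continuousOn.continuousAt (Metric.ball_mem_nhds x one_pos)

theorem exists_lipschitzOnWith_comp (hg : LipschitzOnBounded g) {x : ℝ → H} {K : ℝ≥0} {T : ℝ}
    (hx : LipschitzOnWith K x (Icc 0 T)) :
    ∃ C : ℝ≥0, LipschitzOnWith C (fun t => g (x t)) (Icc 0 T) := by
  obtain ⟨L, hL⟩ := hg _ (isCompact_Icc.image_of_continuousOn hx.continuousOn).isBounded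
  exact ⟨L * K, hL.comp hx (mapsTo_image x _)⟩

end LipschitzOnBounded

end LipschitzOnBounded

section Gradient

variable {H : Type*} [NormedAddCommGroup H] [InnerProductSpace ℝ H] [CompleteSpace H]

theorem le_add_inner_gradient_add_mul_norm_sq {f : H → ℝ} {s : Set H} {K : ℝ≥0}
    (hs : Convex ℝ s) (hf : ∀ x ∈ s, DifferentiableAt ℝ f x)
    (hK : LipschitzOnWith K (gradient f) s) {x y : H} (hx : x ∈ s) (hy : y ∈ s) :
    f y ≤ f x + inner ℝ (gradient f x) (y - x) + K * ‖y - x‖ ^ 2 := by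
  have hseg := hs.segment_subset hx hy
  have hbound : ∀ z ∈ segment ℝ x y, ‖fderiv ℝ f z - fderiv ℝ f x‖ ≤ K * ‖y - x‖ := by
    intro z hz
    rw [← LinearIsometryEquiv.norm_map (InnerProductSpace.toDual ℝ H).symm, map_sub]
    refine (hK.norm_sub_le (hseg hz) hx).trans ?_
    gcongr
    exact norm_sub_le_of_mem_segment hz
  have hmean := (convex_segment x y).norm_image_sub_le_of_norm_hasFDerivWithin_le'
    (fun z hz => (hf z (hseg hz)).hasFDerivAt.hasFDerivWithinAt) hbound
    (left_mem_segment ℝ x y) (right_mem_segment ℝ x y)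
  rw [(hf x hx).hasGradientAt.fderiv_apply, Real.norm_eq_abs] at hmean
  linarith [le_abs_self (f y - f x - inner ℝ (gradient f x) (y - x))]

end Gradient

section Subdifferential

variable {H : Type*} [NormedAddCommGroup H] [InnerProductSpace ℝ H] {φ : H → ℝ} {p : H → H}

theorem inner_sub_nonneg_of_mem_subdifferential {u v p q : H} (hp : p ∈ subdifferential φ u)
    (hq : q ∈ subdifferential φ v) : 0 ≤ inner ℝ (p - q) (u - v) := by
  have hpv := hp v
  rw [← neg_sub u v, inner_neg_right] at hpv
  rw [inner_sub_left]
  linarith [hq u]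

theorem inner_nonneg_of_mem_subdifferential {v p : H} (hp : p ∈ subdifferential φ v)
    (hv : φ 0 ≤ φ v) : 0 ≤ inner ℝ p v := by
  have h₀ := hp 0
  rw [zero_sub, inner_neg_right] at h₀
  linarith

theorem neg_inner_le_of_mem_subdifferential {u v p q : H} {P : ℝ} (hp : p ∈ subdifferential φ u)
    (hq : q ∈ subdifferential φ v) (hP : ‖p‖ ≤ P) (w : H) :
    -inner ℝ p (v - w) ≤ φ w - φ v - inner ℝ q (u - v) + P * ‖u - v‖ := by
  have hsplit : -inner ℝ p (v - w) = inner ℝ p (w - u) + inner ℝ p (u - v) := by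
    rw [← inner_add_right, sub_add_sub_cancel, ← neg_sub v w, inner_neg_right]
  have hcross : inner ℝ p (u - v) ≤ P * ‖u - v‖ :=
    (real_inner_le_norm _ _).trans (mul_le_mul_of_nonneg_right hP (norm_nonneg _))
  linarith [hp w, hq u]

/-- A selection `p` of `∂φ` that is bounded on bounded sets. -/
structure IsBoundedSelection (φ : H → ℝ) (p : H → H) : Prop where
  mem : ∀ v, p v ∈ subdifferential φ v
  exists_norm_le : ∀ R, ∃ P, ∀ v, ‖v‖ ≤ R → ‖p v‖ ≤ P

theorem IsDampingPotential.exists_isBoundedSelection [CompleteSpace H]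
    (hφ : IsDampingPotential φ) : ∃ p, IsBoundedSelection φ p := by
  choose p hp _ using existsUnique_isMinimalSection hφ.convex hφ.continuous
  refine ⟨p, fun v => (hp v).1, fun R => ?_⟩
  obtain ⟨P, hP⟩ := hφ.bounded_minimalSection (max R 1) (by positivity)
  exact ⟨P, fun v hv => hP v (p v) (hv.trans (le_max_left R 1)) (hp v)⟩

end Subdifferential

section PhaseField

variable {H : Type*} [NormedAddCommGroup H]

/-- The bounded subset `‖x‖ ≤ R`, `‖v‖ ≤ V` of the phase space. -/
def phaseBox (H : Type*) [NormedAddCommGroup H] (R V : ℝ) : Set (WithLp 2 (H × H)) :=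
  {z | ‖z.fst‖ ≤ R ∧ ‖z.snd‖ ≤ V}

variable [InnerProductSpace ℝ H]

/-- In the variables `x` and `v = ẋ + β g(x)`, the inclusion
`ẍ + ∂φ(ẋ + β g(x)) + β (g ∘ x)' + g(x) ∋ 0` is the first-order system `ż = phaseField g β z p`
with `z = (x, v)` and `p ∈ ∂φ(v)`, which does not involve the derivative of `g`. -/
noncomputable def phaseField (g : H → H) (β : ℝ) (z : WithLp 2 (H × H)) (p : H) :
    WithLp 2 (H × H) :=
  WithLp.toLp 2 (z.snd - β • g z.fst, -p - g z.fst)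

variable {g : H → H} {φ : H → ℝ} {p : H → H}

theorem inner_phaseField_sub_le {K : ℝ≥0} (β : ℝ) {a b : WithLp 2 (H × H)} {p q : H}
    (hg : ‖g a.fst - g b.fst‖ ≤ K * ‖a.fst - b.fst‖)
    (hpq : 0 ≤ inner ℝ (p - q) (a.snd - b.snd)) :
    inner ℝ (phaseField g β a p - phaseField g β b q) (a - b) ≤
      (1 + K + ‖β‖₊ * K : ℝ≥0) * ‖a - b‖ ^ 2 := by
  have hinner : inner ℝ (phaseField g β a p - phaseField g β b q) (a - b) =
      inner ℝ (a.snd - b.snd) (a.fst - b.fst) - β * inner ℝ (g a.fst - g b.fst) (a.fst - b.fst)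
      - inner ℝ (p - q) (a.snd - b.snd) - inner ℝ (g a.fst - g b.fst) (a.snd - b.snd) := by
    rw [WithLp.prod_inner_apply]
    simp only [phaseField, WithLp.ofLp_sub, Prod.fst_sub, Prod.snd_sub, WithLp.fst, WithLp.snd,
      inner_sub_left, inner_neg_left, real_inner_smul_left]
    ring
  have hcross := real_inner_le_norm (a.snd - b.snd) (a.fst - b.fst)
  have hgx : -(β * inner ℝ (g a.fst - g b.fst) (a.fst - b.fst)) ≤
      |β| * (K * ‖a.fst - b.fst‖ * ‖a.fst - b.fst‖) := by
    refine (neg_le_abs _).trans ?_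
    rw [abs_mul]
    gcongr
    exact (abs_real_inner_le_norm _ _).trans (by gcongr)
  have hgv : -inner ℝ (g a.fst - g b.fst) (a.snd - b.snd) ≤
      K * ‖a.fst - b.fst‖ * ‖a.snd - b.snd‖ :=
    (neg_le_abs _).trans ((abs_real_inner_le_norm _ _).trans (by gcongr))
  have hK := K.coe_nonneg
  have hβK := mul_nonneg (abs_nonneg β) hK
  have hxv := two_mul_le_add_sq ‖a.fst - b.fst‖ ‖a.snd - b.snd‖
  rw [hinner, WithLp.prod_norm_sq_eq_of_L2]
  push_cast
  rw [Real.norm_eq_abs]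
  change _ ≤ (1 + K + |β| * K) * (‖a.fst - b.fst‖ ^ 2 + ‖a.snd - b.snd‖ ^ 2)
  nlinarith [mul_nonneg hK (sq_nonneg ‖a.fst - b.fst‖), mul_nonneg hK (sq_nonneg ‖a.snd - b.snd‖),
    mul_nonneg hβK (sq_nonneg ‖a.snd - b.snd‖), mul_le_mul_of_nonneg_left hxv hK]

theorem exists_norm_phaseField_le (hg : LipschitzOnBounded g) (hp : IsBoundedSelection φ p)
    (β R V : ℝ) : ∃ M : ℝ≥0, ∀ a ∈ phaseBox H R V, ‖phaseField g β a (p a.snd)‖ ≤ M := by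
  obtain ⟨G, hG⟩ := hg.exists_norm_le R
  obtain ⟨P, hP⟩ := hp.exists_norm_le V
  refine ⟨((V + |β| * G) + (P + G)).toNNReal, fun a ⟨hR, hV⟩ => ?_⟩
  have hsplit : phaseField g β a (p a.snd) =
      WithLp.toLp 2 (a.snd - β • g a.fst, 0) + WithLp.toLp 2 (0, -p a.snd - g a.fst) := by
    rw [phaseField, ← WithLp.toLp_add, Prod.mk_add_mk, add_zero, zero_add]
  have hfst : ‖a.snd - β • g a.fst‖ ≤ V + |β| * G := by
    refine (norm_sub_le _ _).trans (add_le_add hV ?_)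
    rw [norm_smul, Real.norm_eq_abs]
    exact mul_le_mul_of_nonneg_left (hG _ hR) (abs_nonneg β)
  have hsnd : ‖-p a.snd - g a.fst‖ ≤ P + G := by
    refine (norm_sub_le _ _).trans (add_le_add ?_ (hG _ hR))
    rw [norm_neg]
    exact hP _ hV
  refine le_trans ?_ (Real.le_coe_toNNReal _)
  rw [hsplit]
  refine (norm_add_le _ _).trans (add_le_add ?_ ?_)
  · rwa [WithLp.norm_toLp_fst]
  · rwa [WithLp.norm_toLp_snd]

theorem exists_oneSidedLipschitzOn_phaseField (hg : LipschitzOnBounded g)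
    (hp : ∀ v, p v ∈ subdifferential φ v) (β R V : ℝ) :
    ∃ L, OneSidedLipschitzOn L (fun a => phaseField g β a (p a.snd)) (phaseBox H R V) := by
  obtain ⟨K, hK⟩ := hg.exists_lipschitzOnWith_closedBall R
  exact ⟨_, fun a ha b hb => inner_phaseField_sub_le β
    (hK.norm_sub_le (mem_closedBall_zero_iff.2 ha.1) (mem_closedBall_zero_iff.2 hb.1))
    (inner_sub_nonneg_of_mem_subdifferential (hp a.snd) (hp b.snd))⟩

end PhaseField

section Energy

variable {H : Type*} [NormedAddCommGroup H]

/-- The mechanical energy of the phase point `z = (x, v)`: it is nonincreasing along the phase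
field, since `⟪∇f(x), ẋ⟫ + ⟪v, v̇⟫ = -β ‖∇f(x)‖² - ⟪p, v⟫`. -/
noncomputable def energy (f : H → ℝ) (z : WithLp 2 (H × H)) : ℝ :=
  f z.fst + ‖z.snd‖ ^ 2 / 2

theorem mem_phaseBox_of_energy_le {f : H → ℝ} {m e r : ℝ} (hm : ∀ x, m ≤ f x)
    {z : WithLp 2 (H × H)} (he : energy f z ≤ e) (hr : energy f z + ‖z.fst‖ ≤ r) :
    z ∈ phaseBox H (r - m) √(2 * (e - m)) := by
  have hmz := hm z.fst
  rw [energy] at he hr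
  refine ⟨?_, Real.le_sqrt_of_sq_le ?_⟩
  · linarith [sq_nonneg ‖z.snd‖]
  · linarith

variable [InnerProductSpace ℝ H]

theorem norm_fst_add_smul_phaseField_le (g : H → H) {β h : ℝ} (hβ : 0 ≤ β) (hh : 0 ≤ h)
    (z : WithLp 2 (H × H)) (p : H) :
    ‖(z + h • phaseField g β z p).fst‖ ≤
      ‖z.fst‖ + h * (‖z.snd‖ + β) + h * (β * ‖g z.fst‖ ^ 2) := by
  have hspeed : ‖z.snd - β • g z.fst‖ ≤ ‖z.snd‖ + β + β * ‖g z.fst‖ ^ 2 := by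
    refine (norm_sub_le _ _).trans ?_
    rw [norm_smul, Real.norm_of_nonneg hβ]
    nlinarith [mul_nonneg hβ (sq_nonneg (‖g z.fst‖ - 1)), mul_nonneg hβ (sq_nonneg ‖g z.fst‖)]
  change ‖z.fst + h • (z.snd - β • g z.fst)‖ ≤ _
  refine (norm_add_le _ _).trans ?_
  rw [norm_smul, Real.norm_of_nonneg hh]
  linarith [mul_le_mul_of_nonneg_left hspeed hh]

variable [CompleteSpace H] {f : H → ℝ} {β : ℝ}

theorem energy_add_smul_phaseField_le {s : Set H} {K : ℝ≥0} (hs : Convex ℝ s)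
    (hf : ∀ x ∈ s, DifferentiableAt ℝ f x) (hK : LipschitzOnWith K (gradient f) s) {h : ℝ}
    (hh : 0 ≤ h) {z : WithLp 2 (H × H)} {p : H} (hp : 0 ≤ inner ℝ p z.snd) (hz : z.fst ∈ s)
    (hz' : (z + h • phaseField (gradient f) β z p).fst ∈ s) :
    energy f (z + h • phaseField (gradient f) β z p) + h * (β * ‖gradient f z.fst‖ ^ 2) ≤
      energy f z + h ^ 2 * ((K + 1) * ‖phaseField (gradient f) β z p‖ ^ 2) := by
  set F := phaseField (gradient f) β z p
  have hfst : (z + h • F).fst = z.fst + h • F.fst := rfl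
  have hsnd : (z + h • F).snd = z.snd + h • F.snd := rfl
  have hpot := le_add_inner_gradient_add_mul_norm_sq hs hf hK hz hz'
  rw [hfst, add_sub_cancel_left, real_inner_smul_right, norm_smul, mul_pow, Real.norm_eq_abs,
    sq_abs] at hpot
  have hkin := norm_add_sq_real z.snd (h • F.snd)
  rw [real_inner_smul_right, norm_smul, mul_pow, Real.norm_eq_abs, sq_abs] at hkin
  have hdiss : inner ℝ (gradient f z.fst) F.fst + inner ℝ z.snd F.snd =
      -(β * ‖gradient f z.fst‖ ^ 2) - inner ℝ p z.snd := by
    change inner ℝ (gradient f z.fst) (z.snd - β • gradient f z.fst) +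
      inner ℝ z.snd (-p - gradient f z.fst) = _
    rw [inner_sub_right, inner_sub_right, inner_neg_right, real_inner_smul_right,
      real_inner_self_eq_norm_sq, real_inner_comm p, real_inner_comm z.snd (gradient f z.fst)]
    ring
  have hnorm := WithLp.prod_norm_sq_eq_of_L2 F
  rw [energy, energy, hsnd, hkin, hfst, hnorm]
  have hrest : 0 ≤ h ^ 2 * (‖F.fst‖ ^ 2 + ‖F.snd‖ ^ 2 / 2 + K * ‖F.snd‖ ^ 2) := by positivity
  linear_combination hpot + h * hdiss + hrest + h * hp

variable {p : H → H}

theorem eventually_energy_eulerStep_le (hf : Differentiable ℝ f)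
    (hf_lip : LipschitzOnBounded (gradient f)) {φ : H → ℝ} (hp : IsBoundedSelection φ p)
    (hp₀ : ∀ v, 0 ≤ inner ℝ (p v) v) (β R V : ℝ) :
    ∀ᶠ h in 𝓝[>] (0 : ℝ), ∀ a ∈ phaseBox H R V,
      energy f (eulerStep (fun z => phaseField (gradient f) β z (p z.snd)) h a) +
        h * (β * ‖gradient f a.fst‖ ^ 2) ≤ energy f a + h := by
  obtain ⟨M, hM⟩ := exists_norm_phaseField_le hf_lip hp β R V
  obtain ⟨K, hK⟩ := hf_lip.exists_lipschitzOnWith_closedBall (R + M)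
  have hcont : Continuous fun h : ℝ => h * ((K + 1) * M ^ 2) := by fun_prop
  have hsmall : ∀ᶠ h : ℝ in 𝓝[>] 0, h * ((K + 1) * M ^ 2) < 1 :=
    nhdsWithin_le_nhds ((hcont.tendsto' 0 0 (zero_mul _)).eventually_lt_const one_pos)
  filter_upwards [hsmall, Ioc_mem_nhdsGT one_pos] with h hKM ⟨hh, hh₁⟩ a ha
  have hfield := hM a ha
  set F := phaseField (gradient f) β a (p a.snd)
  have ha' : (a + h • F).fst ∈ Metric.closedBall 0 (R + M) := by
    refine mem_closedBall_zero_iff.2 ((norm_add_le a.fst (h • F).fst).trans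
      (add_le_add ha.1 ((WithLp.norm_fst_le H _).trans ?_)))
    rw [norm_smul, Real.norm_of_nonneg hh.le]
    exact (mul_le_of_le_one_left (norm_nonneg F) hh₁).trans hfield
  have hstep := energy_add_smul_phaseField_le (convex_closedBall 0 (R + M)) (fun x _ => hf x) hK
    hh.le (hp₀ a.snd) (mem_closedBall_zero_iff.2 (ha.1.trans (le_add_of_nonneg_right M.2))) ha'
  have herr : h ^ 2 * ((K + 1) * ‖F‖ ^ 2) ≤ h := calc
    h ^ 2 * ((K + 1) * ‖F‖ ^ 2) ≤ h ^ 2 * ((K + 1) * M ^ 2) := by gcongr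
    _ = h * (h * ((K + 1) * M ^ 2)) := by ring
    _ ≤ h := mul_le_of_le_one_right hh.le hKM.le
  exact hstep.trans (add_le_add_right herr _)

theorem exists_forall_iterate_eulerStep_mem_phaseBox (hf : Differentiable ℝ f)
    (hf_bdd : BddBelow (range f)) (hf_lip : LipschitzOnBounded (gradient f)) {φ : H → ℝ}
    (hp : IsBoundedSelection φ p) (hp₀ : ∀ v, 0 ≤ inner ℝ (p v) v) (hβ : 0 ≤ β)
    (z₀ : WithLp 2 (H × H)) (T : ℝ) :
    ∃ R V, ∀ᶠ h in 𝓝[>] (0 : ℝ), ∀ n : ℕ, n * h ≤ T →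
      (eulerStep (fun z => phaseField (gradient f) β z (p z.snd)) h)^[n] z₀ ∈ phaseBox H R V := by
  obtain ⟨m, hm⟩ := hf_bdd
  set e := energy f z₀
  set V := √(2 * (e + T - m))
  set R := e + ‖z₀.fst‖ + T * (V + β + 1) - m
  let S : ℝ → Set (WithLp 2 (H × H)) := fun t =>
    {z | energy f z ≤ e + t ∧ energy f z + ‖z.fst‖ ≤ e + ‖z₀.fst‖ + t * (V + β + 1)}
  have hbox : ∀ t ≤ T, S t ⊆ phaseBox H R V := fun t ht z hz =>
    mem_phaseBox_of_energy_le (fun x => hm (mem_range_self x)) (hz.1.trans (by gcongr))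
      (hz.2.trans (by gcongr))
  have h₀ : z₀ ∈ S 0 := ⟨by rw [add_zero], by rw [zero_mul, add_zero]⟩
  refine ⟨R, V, ?_⟩
  filter_upwards [eventually_energy_eulerStep_le hf hf_lip hp hp₀ β R V, self_mem_nhdsWithin]
    with h henergy hh n hn
  have hh : 0 < h := hh
  refine hbox _ hn (iterate_eulerStep_mem hh.le h₀ ?_ hn)
  intro t ht a ha
  have ha_box := hbox t ht.2 ha
  have hstep := henergy a ha_box
  have hfst := norm_fst_add_smul_phaseField_le (gradient f) hβ hh.le a (p a.snd)
  have hdiss : 0 ≤ h * (β * ‖gradient f a.fst‖ ^ 2) := by positivity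
  refine ⟨?_, ?_⟩
  · linarith [ha.1]
  · rw [eulerStep] at hstep ⊢
    linarith [ha.2, mul_le_mul_of_nonneg_left ha_box.2 hh.le]

theorem exists_isKrasovskiiSolution_phaseField (hf : Differentiable ℝ f)
    (hf_bdd : BddBelow (range f)) (hf_lip : LipschitzOnBounded (gradient f)) {φ : H → ℝ}
    (hp : IsBoundedSelection φ p) (hφ : ∀ v, φ 0 ≤ φ v) (hβ : 0 ≤ β) (z₀ : WithLp 2 (H × H)) :
    ∃ z, IsKrasovskiiSolution (fun z => phaseField (gradient f) β z (p z.snd)) z ∧ z 0 = z₀ := by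
  refine exists_isKrasovskiiSolution_of_iterate_eulerStep_mem fun T _ => ?_
  obtain ⟨R, V, hbox⟩ := exists_forall_iterate_eulerStep_mem_phaseBox hf hf_bdd hf_lip hp
    (fun v => inner_nonneg_of_mem_subdifferential (hp.mem v) (hφ v)) hβ z₀ T
  obtain ⟨M, hM⟩ := exists_norm_phaseField_le hf_lip hp β R V
  obtain ⟨L, hL⟩ := exists_oneSidedLipschitzOn_phaseField hf_lip hp.mem β R V
  exact ⟨phaseBox H R V, M, L, hM, hL, hbox⟩

end Energy

section PhaseSolution

variable {H : Type*} [NormedAddCommGroup H] [InnerProductSpace ℝ H] {g : H → H} {φ : H → ℝ}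
  {β : ℝ} {z : ℝ → WithLp 2 (H × H)}

/-- Strong solutions on `[0, +∞)` of the first-order system `ẋ = v - β g(x)`,
`v̇ + ∂φ(v) + g(x) ∋ 0` for the phase point `z = (x, v)`. The first equation has a continuous right
side and is required at every time, the second one almost everywhere. -/
structure IsPhaseSolution (g : H → H) (φ : H → ℝ) (β : ℝ) (z : ℝ → WithLp 2 (H × H)) :
    Prop where
  lipschitz : ∀ T > 0, ∃ K : ℝ≥0, LipschitzOnWith K z (Icc 0 T)
  hasDerivWithinAt_fst : ∀ t ≥ 0,
    HasDerivWithinAt (fun s => (z s).fst) ((z t).snd - β • g (z t).fst) (Ici 0) t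
  inclusion : ∀ᵐ t, 0 < t →
    ∃ p ∈ subdifferential φ (z t).snd, HasDerivAt z (phaseField g β (z t) p) t

theorem IsKrasovskiiSolution.neg_snd_sub_mem_subdifferential {p : H → H} (hg : Continuous g)
    (hp : IsBoundedSelection φ p)
    (hz : IsKrasovskiiSolution (fun a => phaseField g β a (p a.snd)) z) {t : ℝ} (ht : 0 ≤ t)
    {z' : WithLp 2 (H × H)} (hz' : HasDerivWithinAt z z' (Ici 0) t) :
    -z'.snd - g (z t).fst ∈ subdifferential φ (z t).snd := by
  intro w
  obtain ⟨P, hP⟩ := hp.exists_norm_le (‖(z t).snd‖ + 1)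
  have hsnd : Continuous fun a : WithLp 2 (H × H) => a.snd := (WithLp.sndL 2 ℝ H H).continuous
  have hnear : ∀ᶠ a in 𝓝 (z t), ‖a.snd‖ < ‖(z t).snd‖ + 1 :=
    hsnd.norm.continuousAt.eventually_lt_const (lt_add_one _)
  have hle := hz.apply_le_of_hasDerivWithinAt
    ((innerSL ℝ ((z t).snd - w)).comp (WithLp.sndL 2 ℝ H H)) ht hz'
    (Θ := fun a => φ w - φ (z t).snd - inner ℝ (p (z t).snd) (a.snd - (z t).snd) +
      P * ‖a.snd - (z t).snd‖ - inner ℝ (g a.fst) ((z t).snd - w)) (by fun_prop) ?_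
  · change inner ℝ ((z t).snd - w) z'.snd ≤ _ at hle
    simp only [sub_self, inner_zero_right, norm_zero, mul_zero] at hle
    rw [← neg_sub (z t).snd w, inner_neg_right, inner_sub_left, inner_neg_left, real_inner_comm]
    linarith
  · filter_upwards [hnear] with a ha
    change inner ℝ ((z t).snd - w) (-p a.snd - g a.fst) ≤ _
    rw [real_inner_comm, inner_sub_left, inner_neg_left]
    exact sub_le_sub_right
      (neg_inner_le_of_mem_subdifferential (hp.mem _) (hp.mem _) (hP _ ha.le) w) _

theorem IsKrasovskiiSolution.isPhaseSolution [CompleteSpace H] {p : H → H} (hg : Continuous g)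
    (hp : IsBoundedSelection φ p)
    (hz : IsKrasovskiiSolution (fun a => phaseField g β a (p a.snd)) z) :
    IsPhaseSolution g φ β z := by
  have hfst : Continuous fun a : WithLp 2 (H × H) => a.fst := (WithLp.fstL 2 ℝ H H).continuous
  have hsnd : Continuous fun a : WithLp 2 (H × H) => a.snd := (WithLp.sndL 2 ℝ H H).continuous
  have hderiv_fst : ∀ t ≥ 0,
      HasDerivWithinAt (fun s => (z s).fst) ((z t).snd - β • g (z t).fst) (Ici 0) t := fun t ht =>
    hz.hasDerivWithinAt_comp (WithLp.fstL 2 ℝ H H) ht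
      (hsnd.sub ((hg.comp hfst).const_smul β)).continuousAt
  refine ⟨hz.lipschitz, hderiv_fst, ?_⟩
  filter_upwards [ae_differentiableAt_of_forall_lipschitzOnWith_Icc hz.lipschitz] with t hdiff ht
  have hz' := (hdiff ht).hasDerivAt
  refine ⟨_, hz.neg_snd_sub_mem_subdifferential hg hp ht.le hz'.hasDerivWithinAt, ?_⟩
  have hfst' : (deriv z t).fst = (z t).snd - β • g (z t).fst :=
    ((WithLp.fstL 2 ℝ H H).hasFDerivAt.comp_hasDerivAt t hz').unique
      ((hderiv_fst t ht.le).hasDerivAt (Ici_mem_nhds ht))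
  rw [phaseField, ← hfst', neg_sub, sub_neg_eq_add, add_sub_cancel_left]
  exact hz'

theorem exists_isPhaseSolution [CompleteSpace H] {f : H → ℝ} (hf : Differentiable ℝ f)
    (hf_bdd : BddBelow (range f)) (hf_lip : LipschitzOnBounded (gradient f))
    (hφ : IsDampingPotential φ) (hβ : 0 ≤ β) (z₀ : WithLp 2 (H × H)) :
    ∃ z, IsPhaseSolution (gradient f) φ β z ∧ z 0 = z₀ := by
  obtain ⟨p, hp⟩ := hφ.exists_isBoundedSelection
  obtain ⟨z, hz, hz₀⟩ := exists_isKrasovskiiSolution_phaseField hf hf_bdd hf_lip hp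
    (fun v => hφ.map_zero.trans_le (hφ.nonneg v)) hβ z₀
  exact ⟨z, hz.isPhaseSolution hf_lip.continuous hp, hz₀⟩

end PhaseSolution

section Gronwall

theorem le_mul_exp_of_ae_deriv_le_mul {D : ℝ → ℝ} {K a b : ℝ} (hab : a ≤ b)
    (hD : AbsolutelyContinuousOnInterval D a b)
    (hd : ∀ᵐ t, t ∈ Ioo a b → ∃ d, HasDerivAt D d t ∧ d ≤ K * D t) :
    D b ≤ D a * Real.exp (K * (b - a)) := by
  set Q : ℝ → ℝ := (fun t => Real.exp (-K * t)) * D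
  have hQ : AbsolutelyContinuousOnInterval Q a b := by
    have hexp : ContDiff ℝ 1 fun t => Real.exp (-K * t) := by fun_prop
    exact hexp.contDiffOn.absolutelyContinuousOnInterval.mul hD
  have hderiv : ∀ᵐ t ∂volume.restrict (Icc a b), 0 ≤ -deriv Q t := by
    rw [← restrict_Ioo_eq_restrict_Icc, ae_restrict_iff' measurableSet_Ioo]
    filter_upwards [hd] with t ht htab
    obtain ⟨d, hDt, hdK⟩ := ht htab
    have hexp : HasDerivAt (fun s => Real.exp (-K * s)) (Real.exp (-K * t) * -K) t := by
      simpa only [mul_one] using! ((hasDerivAt_id t).const_mul (-K)).exp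
    rw [(hexp.mul hDt).deriv]
    nlinarith [Real.exp_pos (-K * t)]
  have hdecr : Q b ≤ Q a := by
    have hint := intervalIntegral.integral_nonneg_of_ae_restrict hab hderiv
    rw [intervalIntegral.integral_neg, hQ.integral_deriv_eq_sub] at hint
    linarith
  calc D b = Real.exp (K * b) * Q b := by simp [Q, ← mul_assoc, ← Real.exp_add]
    _ ≤ Real.exp (K * b) * Q a := by gcongr
    _ = D a * Real.exp (K * (b - a)) := by
      simp only [Q, Pi.mul_apply]
      rw [← mul_assoc, ← Real.exp_add, mul_comm]
      ring_nf

variable {E : Type*} [NormedAddCommGroup E] [InnerProductSpace ℝ E]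

theorem eq_of_ae_inner_deriv_sub_le {z w : ℝ → E} {K L : ℝ≥0} {C a b : ℝ} (hab : a ≤ b)
    (hz : LipschitzOnWith K z (Icc a b)) (hw : LipschitzOnWith L w (Icc a b)) (ha : z a = w a)
    (hzw : ∀ᵐ t, t ∈ Ioo a b → ∃ z' w', HasDerivAt z z' t ∧ HasDerivAt w w' t ∧
      inner ℝ (z' - w') (z t - w t) ≤ C * ‖z t - w t‖ ^ 2) : z b = w b := by
  have hnorm : AbsolutelyContinuousOnInterval (fun t => ‖z t - w t‖) a b := by
    refine (lipschitzWith_one_norm.comp_lipschitzOnWith (?_ : LipschitzOnWith (K + L)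
      (fun t => z t - w t) (uIcc a b))).absolutelyContinuousOnInterval
    rw [uIcc_of_le hab]
    exact hz.sub hw
  have hsq : AbsolutelyContinuousOnInterval (fun t => ‖z t - w t‖ ^ 2) a b := by
    simpa only [pow_two] using! hnorm.mul hnorm
  have hgronwall := le_mul_exp_of_ae_deriv_le_mul (K := 2 * C) hab hsq (by
    filter_upwards [hzw] with t ht htab
    obtain ⟨z', w', hz', hw', hinner⟩ := ht htab
    refine ⟨_, (hz'.sub hw').norm_sq, ?_⟩
    rw [Pi.sub_apply, real_inner_comm]
    linarith)
  rw [ha, sub_self, norm_zero, zero_pow two_ne_zero, zero_mul] at hgronwall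
  exact sub_eq_zero.1 (norm_eq_zero.1 (pow_eq_zero_iff two_ne_zero |>.1
    (le_antisymm hgronwall (sq_nonneg _))))

end Gronwall

section Uniqueness

variable {H : Type*} [NormedAddCommGroup H] [InnerProductSpace ℝ H] {g : H → H} {φ : H → ℝ}
  {β : ℝ} {z w : ℝ → WithLp 2 (H × H)}

theorem IsPhaseSolution.eqOn (hz : IsPhaseSolution g φ β z) (hw : IsPhaseSolution g φ β w)
    (hg : LipschitzOnBounded g) (h₀ : z 0 = w 0) : EqOn z w (Ici 0) := by
  intro T hT
  rcases (mem_Ici.1 hT).eq_or_lt with rfl | hpos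
  · exact h₀
  obtain ⟨Kz, hKz⟩ := hz.lipschitz T hpos
  obtain ⟨Kw, hKw⟩ := hw.lipschitz T hpos
  have hfst : Continuous fun a : WithLp 2 (H × H) => a.fst := (WithLp.fstL 2 ℝ H H).continuous
  obtain ⟨K, hK⟩ := hg ((fun t => (z t).fst) '' Icc 0 T ∪ (fun t => (w t).fst) '' Icc 0 T)
    ((isCompact_Icc.image_of_continuousOn (hfst.comp_continuousOn hKz.continuousOn)).union
      (isCompact_Icc.image_of_continuousOn (hfst.comp_continuousOn hKw.continuousOn))).isBounded
  refine eq_of_ae_inner_deriv_sub_le (C := (1 + K + ‖β‖₊ * K : ℝ≥0)) hpos.le hKz hKw h₀ ?_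
  filter_upwards [hz.inclusion, hw.inclusion] with t htz htw ht
  obtain ⟨p, hp, hz'⟩ := htz ht.1
  obtain ⟨q, hq, hw'⟩ := htw ht.1
  have ht' := Ioo_subset_Icc_self ht
  exact ⟨_, _, hz', hw', inner_phaseField_sub_le β
    (hK.norm_sub_le (.inl (mem_image_of_mem _ ht')) (.inr (mem_image_of_mem _ ht')))
    (inner_sub_nonneg_of_mem_subdifferential hp hq)⟩

end Uniqueness

section Equivalence

variable {H : Type*} [NormedAddCommGroup H] [InnerProductSpace ℝ H] {f φ : H → ℝ} {β : ℝ}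

namespace IsPhaseSolution

variable {z : ℝ → WithLp 2 (H × H)}

theorem velocity_fst {g : H → H} (hz : IsPhaseSolution g φ β z) {t : ℝ} (ht : 0 ≤ t) :
    velocity (fun s => (z s).fst) t = (z t).snd - β • g (z t).fst :=
  (hz.hasDerivWithinAt_fst t ht).derivWithin (uniqueDiffOn_Ici 0 t ht)

theorem exists_lipschitzOnWith_velocity {g : H → H} (hz : IsPhaseSolution g φ β z)
    (hg : LipschitzOnBounded g) {T : ℝ} (hT : 0 < T) :
    ∃ K : ℝ≥0, LipschitzOnWith K (velocity fun s => (z s).fst) (Icc 0 T) := by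
  obtain ⟨K, hK⟩ := hz.lipschitz T hT
  have hfst := (WithLp.fstL 2 ℝ H H).lipschitz.comp_lipschitzOnWith hK
  have hsnd := (WithLp.sndL 2 ℝ H H).lipschitz.comp_lipschitzOnWith hK
  obtain ⟨L, hL⟩ := hg.exists_lipschitzOnWith_comp hfst
  have hvel := hsnd.sub ((lipschitzWith_smul β).comp_lipschitzOnWith hL)
  refine ⟨‖WithLp.sndL 2 ℝ H H‖₊ * K + ‖β‖₊ * L, fun s hs t ht => ?_⟩
  rw [hz.velocity_fst hs.1, hz.velocity_fst ht.1]
  exact hvel hs ht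

variable [CompleteSpace H]

theorem hasDerivAt_velocity_fst (hz : IsPhaseSolution (gradient f) φ β z)
    (hf : Differentiable ℝ (gradient f)) {t : ℝ} (ht : 0 < t) {z' : WithLp 2 (H × H)}
    (hz' : HasDerivAt z z' t) :
    HasDerivAt (velocity fun s => (z s).fst)
      (z'.snd - β • hessian f (z t).fst (velocity (fun s => (z s).fst) t)) t := by
  have hfst : HasDerivAt (fun s => (z s).fst) (velocity (fun s => (z s).fst) t) t := by
    rw [hz.velocity_fst ht.le]
    exact (hz.hasDerivWithinAt_fst t ht.le).hasDerivAt (Ici_mem_nhds ht)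
  have hsnd : HasDerivAt (fun s => (z s).snd) z'.snd t :=
    (WithLp.sndL 2 ℝ H H).hasFDerivAt.comp_hasDerivAt t hz'
  have hgrad : HasDerivAt (fun s => gradient f (z s).fst)
      (hessian f (z t).fst (velocity (fun s => (z s).fst) t)) t :=
    (hf (z t).fst).hasFDerivAt.comp_hasDerivAt (f := fun s => (z s).fst) t hfst
  refine (hsnd.sub (hgrad.const_smul β)).congr_of_eventuallyEq ?_
  filter_upwards [Ici_mem_nhds ht] with s hs
  exact hz.velocity_fst hs

theorem isStrongGlobalSolution_fst (hz : IsPhaseSolution (gradient f) φ β z)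
    (hf : Differentiable ℝ (gradient f)) (hf_lip : LipschitzOnBounded (gradient f)) :
    IsStrongGlobalSolution f φ β fun t => (z t).fst where
  contDiffOn := by
    refine (contDiffOn_one_iff_derivWithin (uniqueDiffOn_Ici 0)).2
      ⟨fun t ht => (hz.hasDerivWithinAt_fst t ht).differentiableWithinAt, fun t ht => ?_⟩
    obtain ⟨K, hK⟩ := hz.exists_lipschitzOnWith_velocity hf_lip (T := t + 1)
      (add_pos_of_nonneg_of_pos ht one_pos)
    refine (hK.continuousOn t ⟨ht, (lt_add_one t).le⟩).mono_of_mem_nhdsWithin ?_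
    exact mem_nhdsWithin.2 ⟨Iio (t + 1), isOpen_Iio, lt_add_one t, fun s hs => ⟨hs.2, hs.1.le⟩⟩
  lipschitz_velocity T hT := by
    obtain ⟨K, hK⟩ := hz.exists_lipschitzOnWith_velocity hf_lip hT
    exact ⟨K, hK.mono Ioo_subset_Icc_self⟩
  memLp_acceleration T hT := by
    obtain ⟨K, hK⟩ := hz.exists_lipschitzOnWith_velocity hf_lip hT
    refine memLp_top_of_bound (aestronglyMeasurable_deriv _ _) K ?_
    filter_upwards [ae_restrict_mem measurableSet_Ioo] with t ht
    exact norm_deriv_le_of_lipschitzOn (Icc_mem_nhds ht.1 ht.2) hK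
  inclusion := by
    rw [ae_restrict_iff' measurableSet_Ioi]
    filter_upwards [hz.inclusion] with t ht ht₀
    obtain ⟨p, hp, hz'⟩ := ht ht₀
    have hvel := hz.hasDerivAt_velocity_fst hf ht₀ hz'
    refine ⟨hvel.differentiableAt, p, ?_, ?_⟩
    · rwa [hz.velocity_fst (le_of_lt ht₀), sub_add_cancel]
    · rw [acceleration, hvel.deriv]
      change -p - gradient f (z t).fst - _ + p + _ + gradient f (z t).fst = 0
      abel

end IsPhaseSolution

namespace IsStrongGlobalSolution

variable [CompleteSpace H] {x : ℝ → H}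

theorem continuousOn_velocity (hx : IsStrongGlobalSolution f φ β x) :
    ContinuousOn (velocity x) (Ici 0) :=
  hx.contDiffOn.continuousOn_derivWithin (uniqueDiffOn_Ici 0) le_rfl

theorem hasDerivWithinAt (hx : IsStrongGlobalSolution f φ β x) {t : ℝ} (ht : 0 ≤ t) :
    HasDerivWithinAt x (velocity x t) (Ici 0) t :=
  (hx.contDiffOn.differentiableOn one_ne_zero t ht).hasDerivWithinAt

theorem exists_lipschitzOnWith (hx : IsStrongGlobalSolution f φ β x) (T : ℝ) :
    ∃ K : ℝ≥0, LipschitzOnWith K x (Icc 0 T) := by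
  obtain ⟨R, hR⟩ := (isCompact_Icc (a := 0) (b := T)).exists_bound_of_continuousOn
    (hx.continuousOn_velocity.mono Icc_subset_Ici_self)
  refine ⟨R.toNNReal, (convex_Icc 0 T).lipschitzOnWith_of_nnnorm_hasDerivWithin_le
    (fun t ht => (hx.hasDerivWithinAt ht.1).mono Icc_subset_Ici_self) fun t ht => ?_⟩
  rw [← NNReal.coe_le_coe, coe_nnnorm]
  exact (hR t ht).trans (Real.le_coe_toNNReal R)

theorem exists_lipschitzOnWith_velocity (hx : IsStrongGlobalSolution f φ β x) {T : ℝ}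
    (hT : 0 < T) : ∃ K : ℝ≥0, LipschitzOnWith K (velocity x) (Icc 0 T) := by
  obtain ⟨K, hK⟩ := hx.lipschitz_velocity T hT
  rw [← closure_Ioo hT.ne]
  refine ⟨K, hK.closure ?_⟩
  rw [closure_Ioo hT.ne]
  exact hx.continuousOn_velocity.mono Icc_subset_Ici_self

theorem isPhaseSolution (hx : IsStrongGlobalSolution f φ β x)
    (hf : Differentiable ℝ (gradient f)) (hf_lip : LipschitzOnBounded (gradient f)) :
    IsPhaseSolution (gradient f) φ β
      fun t => WithLp.toLp 2 (x t, velocity x t + β • gradient f (x t)) where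
  lipschitz T hT := by
    obtain ⟨K, hK⟩ := hx.exists_lipschitzOnWith T
    obtain ⟨L, hL⟩ := hx.exists_lipschitzOnWith_velocity hT
    obtain ⟨G, hG⟩ := hf_lip.exists_lipschitzOnWith_comp hK
    exact ⟨_, (WithLp.prodContinuousLinearEquiv 2 ℝ H H).symm.lipschitz.comp_lipschitzOnWith
      (hK.prodMk (hL.add ((lipschitzWith_smul β).comp_lipschitzOnWith hG)))⟩
  hasDerivWithinAt_fst t ht := by
    change HasDerivWithinAt x (velocity x t + β • gradient f (x t) - β • gradient f (x t)) (Ici 0) t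
    rw [add_sub_cancel_right]
    exact hx.hasDerivWithinAt ht
  inclusion := by
    have hincl := hx.inclusion
    rw [ae_restrict_iff' measurableSet_Ioi] at hincl
    filter_upwards [hincl] with t ht ht₀
    obtain ⟨hdiff, p, hp, heq⟩ := ht ht₀
    refine ⟨p, hp, ?_⟩
    have hx' := (hx.hasDerivWithinAt ht₀.le).hasDerivAt (Ici_mem_nhds ht₀)
    have hgrad : HasDerivAt (fun s => gradient f (x s)) (hessian f (x t) (velocity x t)) t :=
      (hf (x t)).hasFDerivAt.comp_hasDerivAt t hx'
    have hv' := hdiff.hasDerivAt.add (hgrad.const_smul β)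
    have hforce : -p - gradient f (x t) =
        acceleration x t + β • hessian f (x t) (velocity x t) := by
      rw [← sub_eq_zero, ← neg_eq_zero, ← heq]
      abel
    have hfield : phaseField (gradient f) β
        (WithLp.toLp 2 (x t, velocity x t + β • gradient f (x t))) p =
        WithLp.toLp 2 (velocity x t, acceleration x t + β • hessian f (x t) (velocity x t)) := by
      rw [← hforce]
      exact congrArg (fun w => WithLp.toLp 2 (w, -p - gradient f (x t)))
        (add_sub_cancel_right (velocity x t) (β • gradient f (x t)))
    rw [hfield]
    exact (WithLp.prodContinuousLinearEquiv 2 ℝ H H).symm.hasFDerivAt.comp_hasDerivAt t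
      (hx'.prodMk hv')

end IsStrongGlobalSolution

theorem differentiable_gradient [CompleteSpace H] (hf : ContDiff ℝ 2 f) :
    Differentiable ℝ (gradient f) := by
  have hdual : Differentiable ℝ (InnerProductSpace.toDual ℝ H).symm :=
    (InnerProductSpace.toDual ℝ H).symm.toContinuousLinearEquiv.differentiable
  exact hdual.comp ((hf.fderiv_right (m := 1) le_rfl).differentiable one_ne_zero)

end Equivalence

end ADIGE

theorem mainTheorem10_general {H : Type*} [NormedAddCommGroup H] [InnerProductSpace ℝ H]
    [CompleteSpace H] {f φ : H → ℝ} {β : ℝ} (hf : Differentiable ℝ f)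
    (hf' : Differentiable ℝ (gradient f)) (hf_bdd : BddBelow (range f))
    (hf_lip : ADIGE.LipschitzOnBounded (gradient f)) (hφ : ADIGE.IsDampingPotential φ)
    (hβ : 0 ≤ β) (x₀ x₁ : H) :
    ∃ x : ℝ → H,
      (ADIGE.IsStrongGlobalSolution f φ β x ∧ x 0 = x₀ ∧ ADIGE.velocity x 0 = x₁) ∧
      ∀ y : ℝ → H,
        (ADIGE.IsStrongGlobalSolution f φ β y ∧ y 0 = x₀ ∧ ADIGE.velocity y 0 = x₁) →
        EqOn y x (Ici 0) := by
  obtain ⟨z, hz, hz₀⟩ := ADIGE.exists_isPhaseSolution hf hf_bdd hf_lip hφ hβ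
    (WithLp.toLp 2 (x₀, x₁ + β • gradient f x₀))
  refine ⟨fun t => (z t).fst, ⟨hz.isStrongGlobalSolution_fst hf' hf_lip, ?_, ?_⟩, ?_⟩
  · exact congrArg WithLp.fst hz₀
  · rw [hz.velocity_fst le_rfl, hz₀]
    exact add_sub_cancel_right x₁ _
  · rintro y ⟨hy, rfl, rfl⟩ t ht
    exact congrArg WithLp.fst ((hy.isPhaseSolution hf' hf_lip).eqOn hz hf_lip hz₀.symm ht)

theorem mainTheorem10 {H : Type*} [NormedAddCommGroup H] [InnerProductSpace ℝ H]
    [CompleteSpace H] (f : H → ℝ) (hf_convex : ConvexOn ℝ Set.univ f) (hf_C2 : ContDiff ℝ 2 f)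
    (hf_bdd : BddBelow (Set.range f)) (hf_lip : ADIGE.LipschitzOnBounded (gradient f))
    (φ : H → ℝ) (hφ : ADIGE.IsDampingPotential φ) (β : ℝ) (hβ : 0 ≤ β) (x₀ x₁ : H) :
    ∃ x : ℝ → H,
      (ADIGE.IsStrongGlobalSolution f φ β x ∧ x 0 = x₀ ∧ ADIGE.velocity x 0 = x₁) ∧
      ∀ y : ℝ → H,
        (ADIGE.IsStrongGlobalSolution f φ β y ∧ y 0 = x₀ ∧ ADIGE.velocity y 0 = x₁) →
        Set.EqOn y x (Set.Ici 0) :=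
  mainTheorem10_general (hf_C2.differentiable two_ne_zero) (ADIGE.differentiable_gradient hf_C2)
    hf_bdd hf_lip hφ hβ x₀ x₁
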